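/- **Logic.** Formulas over a first-order language with equality are built from atomic formulas ($s=t$, relation symbols, $\top$, $\bot$) by $\wedge,\vee,\exists x$ and, for every finite sequence $\mathbf x$ of variables, $\forall\mathbf x(A\to B)$; write $A\to B$ when $\mathbf x$ is empty, and $A\leftrightarrow B$ for $(A\to B)\wedge(B\to A)$. Basic predicate calculus BQC derives sequents $A\Rightarrow B$. Its axioms are $A\Rightarrow A$; $A\Rightarrow\top$; $\bot\Rightarrow A$; $A\wedge(B\vee C)\Rightarrow(A\wedge B)\vee(A\wedge C)$; $A\wedge\exists xB\Rightarrow\exists x(A\wedge B)$ ($x$ not free in $A$); $\top\Rightarrow x=x$; $x=y\wedge A\Rightarrow A[x/y]$ ($A$ atomic); $\forall\mathbf x(A\to B)\wedge\forall\mathbf x(B\to C)\Rightarrow\forall\mathbf x(A\to C)$; $\forall\mathbf x(A\to B)\wedge\forall\mathbf x(A\to C)\Rightarrow\forall\mathbf x(A\to B\wedge C)$; $\forall\mathbf x(B\to A)\wedge\forall\mathbf x(C\to A)\Rightarrow\forall\mathbf x(B\vee C\to A)$; $\forall\mathbf x(A\to B)\Rightarrow\forall\mathbf x(A[\mathbf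 x/\mathbf t]\to B[\mathbf x/\mathbf t])$ (no variable of $\mathbf t$ is bound in $A$ or $B$); $\forall\mathbf x(A\to B)\Rightarrow\forall\mathbf y(A\to B)$ (no variable of $\mathbf y$ free on the left); $\forall\mathbf yx(B\to A)\Rightarrow\forall\mathbf y(\exists xB\to A)$ ($x$ not free in $A$). Its rules are cut; from $A\Rightarrow B$ and $A\Rightarrow C$ infer $A\Rightarrow B\wedge C$, and conversely; from $B\Rightarrow A$ and $C\Rightarrow A$ infer $B\vee C\Rightarrow A$, and conversely; from $A\Rightarrow B$ infer $A[\mathbf x/\mathbf t]\Rightarrow B[\mathbf x/\mathbf t]$ (no variable of $\mathbf t$ is bound in the conclusion); from $B\Rightarrow A$ infer $\exists xB\Rightarrow A$, and conversely ($x$ not free in $A$); from $A\wedge B\Rightarrow C$ infer $A\Rightarrow\forall\mathbf x(B\to C)$ (no variable of $\mathbf x$ free in $A$). **Theories.** $T+\Gamma$ is $T$ with the sequents of $\Gamma$ as additional axioms, and $T\vdash A$ means $T\vdash\top\Rightarrow A$. Basic Arithmetic BA, in the language $\{0,S,+,\cdot\}$, is BQC with the axioms $Sx=0\Rightarrow\bot$;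 $Sx=Sy\Rightarrow x=y$; $x+0=x$; $x+Sy=S(x+y)$; $x\cdot0=0$; $x\cdot Sy=x\cdot y+x$; $\forall\mathbf yx(A\to A[x/Sx])\Rightarrow\forall\mathbf yx(A[x/0]\to A)$; and the rule: from $A\Rightarrow A[x/Sx]$ infer $A[x/0]\Rightarrow A$. Heyting Arithmetic HA is BA with the schema $\top\to A\Rightarrow A$. $\mathrm{BA}+\mathrm U$ is BA with $x+z=y+z\Rightarrow x=y$. Let $s<t$ abbreviate $\exists z(s+Sz=t)$ with $z$ not in $s,t$, and $s\le t$ abbreviate $s<t\vee s=t$. $\mathrm{BA}_c$ is formulated as BA (with BQC and both forms of induction for all formulas of the language) in $\{0,S,+,\cdot,\dot-\}$, with the additional axioms $x\le y\Rightarrow x\mathbin{\dot-}y=0$ and $y\le x\Rightarrow Sx\mathbin{\dot-}y=S(x\mathbin{\dot-}y)$. **Formula classes.** $\Delta_0$ is the least class that contains the atomic formulas and is closed under $\wedge,\vee,\to$ and under forming $\exists x(x<s\wedge A)$ and $\forall x(x<s\to A)$, $s$ a term in which $x$ does not occur. $\Sigma_1$ formulas are $\exists\mathbf x\,A$ with $A\in\Delta_0$.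 $\exists_1^+$ formulas are $\exists\mathbf x\,A$ with $A$ built from atomic formulas by $\wedge,\vee$. The positive part $A^\exists$ of $A$ is obtained by replacing every outermost subformula $\forall\mathbf x(B\to C)$ by $\top$; $\Gamma^\exists=\{A^\exists\Rightarrow B^\exists : (A\Rightarrow B)\in\Gamma\}$. **MRDP.** For a theory $T$, "$T\vdash\mathrm{MRDP}$" means that for every $\Sigma_1$ formula $A$ of the language of $T$ there is an $\exists_1^+$ formula $B$ of that language with the same free variables such that $T\vdash A\Rightarrow B$ and $T\vdash B\Rightarrow A$. "$T\vdash\mathrm{MRDP}^w$" is the same with $T\vdash A\leftrightarrow B$ instead. **Theorem.** 1. Let $\Gamma$ be any set of sequents in the language $\{0,S,+,\cdot\}$. If $\mathrm{HA}+\Gamma^\exists\nvdash\bot$, then $\mathrm{BA}+\Gamma^\exists\nvdash\mathrm{MRDP}^w$. Specifically, for the $\Sigma_1$ sentence $\top\to\bot$ there is no $\exists_1^+$ sentence $B$ such that $\mathrm{BA}+\Gamma^\exists\vdash(\top\to\bot)\leftrightarrow B$. 2. For each $T\in\{\mathrm{BA},\ \mathrm{BA}+\mathrm U,\ \mathrm{BA}_c\}$,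 neither $T\vdash\mathrm{MRDP}^w$ nor $T\vdash\mathrm{MRDP}$; again $\top\to\bot$ is a $\Sigma_1$ sentence for which no $\exists_1^+$ sentence $B$ of the language of $T$ satisfies $T\vdash(\top\to\bot)\leftrightarrow B$. -/

import Mathlib

namespace BasicArith

section Logic

variable (L : FirstOrder.Language.{0, 0})

/-- Formulas of basic predicate calculus over the language `L` with equality, with variables
named by natural numbers. Universal quantification is available only in the form
`all xs A B`, that is `∀ xs (A → B)`, for a finite sequence `xs` of variables. -/
inductive Formula : Type
  | top : Formula
  | bot : Formula
  | eq (s t : L.Term ℕ) : Formula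
  | rel {n : ℕ} (R : L.Relations n) (ts : Fin n → L.Term ℕ) : Formula
  | and (A B : Formula) : Formula
  | or (A B : Formula) : Formula
  | ex (x : ℕ) (A : Formula) : Formula
  | all (xs : List ℕ) (A B : Formula) : Formula

/-- A sequent `A ⇒ B`. -/
structure Sequent : Type where
  ante : Formula L
  conc : Formula L

/-- A rule, inferring a sequent from finitely many sequents. -/
structure Rule : Type where
  premises : List (Sequent L)
  conclusion : Sequent L

/-- A theory: a set of sequents and rules. -/
structure Theory : Type where
  sequents : Set (Sequent L)
  rules : Set (Rule L)

end Logic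

variable {L : FirstOrder.Language.{0, 0}}

namespace Formula

/-- The implication `A → B`, i.e. `∀ xs (A → B)` for the empty sequence `xs`. -/
def imp (A B : Formula L) : Formula L := all [] A B

/-- The internal equivalence `A ↔ B`. -/
def iff (A B : Formula L) : Formula L := and (imp A B) (imp B A)

/-- `∃ x₁ … ∃ xₙ A`. -/
def exs (xs : List ℕ) (A : Formula L) : Formula L := xs.foldr ex A

/-- Atomic formulas, `⊤` and `⊥` included. -/
inductive IsAtomic : Formula L → Prop
  | top : IsAtomic top
  | bot : IsAtomic bot
  | eq (s t : L.Term ℕ) : IsAtomic (eq s t)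
  | rel {n : ℕ} (R : L.Relations n) (ts : Fin n → L.Term ℕ) : IsAtomic (rel R ts)

/-- The variables that occur free. -/
def freeVars : Formula L → Finset ℕ
  | top => ∅
  | bot => ∅
  | eq s t => s.varFinset ∪ t.varFinset
  | rel _ ts => Finset.univ.biUnion fun i => (ts i).varFinset
  | and A B => A.freeVars ∪ B.freeVars
  | or A B => A.freeVars ∪ B.freeVars
  | ex x A => A.freeVars \ {x}
  | all xs A B => (A.freeVars ∪ B.freeVars) \ xs.toFinset

/-- The variables that are bound by some quantifier of the formula. -/
def boundVars : Formula L → Finset ℕ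
  | top => ∅
  | bot => ∅
  | eq _ _ => ∅
  | rel _ _ => ∅
  | and A B => A.boundVars ∪ B.boundVars
  | or A B => A.boundVars ∪ B.boundVars
  | ex x A => insert x A.boundVars
  | all xs A B => xs.toFinset ∪ (A.boundVars ∪ B.boundVars)

/-- Simultaneous substitution of `σ v` for all free occurrences of each variable `v`. Bound
variables are not renamed; capture is excluded by side conditions where it could occur. -/
def subst : Formula L → (ℕ → L.Term ℕ) → Formula L
  | top, _ => top
  | bot, _ => bot
  | eq s t, σ => eq (s.subst σ) (t.subst σ)
  | rel R ts, σ => rel R fun i => (ts i).subst σ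
  | and A B, σ => and (A.subst σ) (B.subst σ)
  | or A B, σ => or (A.subst σ) (B.subst σ)
  | ex x A, σ => ex x (A.subst fun v => if v = x then FirstOrder.Language.Term.var v else σ v)
  | all xs A B, σ =>
      all xs (A.subst fun v => if v ∈ xs then FirstOrder.Language.Term.var v else σ v)
        (B.subst fun v => if v ∈ xs then FirstOrder.Language.Term.var v else σ v)

/-- `A[x/t]` for a single variable `x`. -/
def subst1 (A : Formula L) (x : ℕ) (t : L.Term ℕ) : Formula L :=
  A.subst fun v => if v = x then t else FirstOrder.Language.Term.var v

/-- The positive part `A^∃` of a formula. -/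
def positivePart : Formula L → Formula L
  | top => top
  | bot => bot
  | eq s t => eq s t
  | rel R ts => rel R ts
  | and A B => and A.positivePart B.positivePart
  | or A B => or A.positivePart B.positivePart
  | ex x A => ex x A.positivePart
  | all _ _ _ => top

/-- Quantifier-free formulas without implications. -/
inductive IsPositiveQF : Formula L → Prop
  | atomic {A : Formula L} : IsAtomic A → IsPositiveQF A
  | and {A B : Formula L} : IsPositiveQF A → IsPositiveQF B → IsPositiveQF (and A B)
  | or {A B : Formula L} : IsPositiveQF A → IsPositiveQF B → IsPositiveQF (or A B)

/-- `∃₁⁺` formulas: `∃ xs A` with `A` positive and quantifier-free. -/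
def IsPositiveExistential (A : Formula L) : Prop :=
  ∃ (xs : List ℕ) (C : Formula L), IsPositiveQF C ∧ A = exs xs C

end Formula

open Formula

/-- `Γ^∃`, the set of all `A^∃ ⇒ B^∃` with `A ⇒ B` in `Γ`. -/
def positiveSequents (Γ : Set (Sequent L)) : Set (Sequent L) :=
  (fun S => ⟨S.ante.positivePart, S.conc.positivePart⟩) '' Γ

/-- `IsSubstitution xs σ` says that `σ` is a substitution `[xs/ts]`: it changes
no variable outside the sequence `xs`. -/
def IsSubstitution (xs : List ℕ) (σ : ℕ → L.Term ℕ) : Prop :=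
  ∀ v, v ∉ xs → σ v = FirstOrder.Language.Term.var v

/-- No variable of the terms `ts` in the substitution `σ = [xs/ts]` is bound by a quantifier
of `A`. -/
def FreeForSubst (xs : List ℕ) (σ : ℕ → L.Term ℕ) (A : Formula L) : Prop :=
  ∀ v ∈ xs, ∀ w ∈ (σ v).varFinset, w ∉ A.boundVars

/-- `Derives T A B`: the sequent `A ⇒ B` is derivable from the sequents and rules of `T` by the
axioms and rules of basic predicate calculus `BQC`. -/
inductive Derives (T : Theory L) : Formula L → Formula L → Prop
  | ofSequent (S : Sequent L) (h : S ∈ T.sequents) : Derives T S.ante S.conc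
  | ofRule (R : Rule L) (h : R ∈ T.rules)
      (hp : ∀ S ∈ R.premises, Derives T S.ante S.conc) :
      Derives T R.conclusion.ante R.conclusion.conc
  | refl (A : Formula L) : Derives T A A
  | top_intro (A : Formula L) : Derives T A top
  | bot_elim (A : Formula L) : Derives T bot A
  | and_or (A B C : Formula L) : Derives T (and A (or B C)) (or (and A B) (and A C))
  | and_ex (x : ℕ) (A B : Formula L) (hx : x ∉ A.freeVars) :
      Derives T (and A (ex x B)) (ex x (and A B))
  | eq_refl (x : ℕ) : Derives T top (eq (FirstOrder.Language.Term.var x) (FirstOrder.Language.Term.var x))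
  | eq_subst (x y : ℕ) (A : Formula L) (hA : IsAtomic A) :
      Derives T (and (eq (FirstOrder.Language.Term.var x) (FirstOrder.Language.Term.var y)) A)
        (A.subst1 x (FirstOrder.Language.Term.var y))
  | all_trans (xs : List ℕ) (A B C : Formula L) :
      Derives T (and (all xs A B) (all xs B C)) (all xs A C)
  | all_and (xs : List ℕ) (A B C : Formula L) :
      Derives T (and (all xs A B) (all xs A C)) (all xs A (and B C))
  | all_or (xs : List ℕ) (A B C : Formula L) :
      Derives T (and (all xs B A) (all xs C A)) (all xs (or B C) A)
  | all_subst (xs : List ℕ) (σ : ℕ → L.Term ℕ) (A B : Formula L)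
      (hσ : IsSubstitution xs σ) (hA : FreeForSubst xs σ A) (hB : FreeForSubst xs σ B) :
      Derives T (all xs A B) (all xs (A.subst σ) (B.subst σ))
  | all_requantify (xs ys : List ℕ) (A B : Formula L)
      (hy : ∀ y ∈ ys, y ∉ (all xs A B).freeVars) :
      Derives T (all xs A B) (all ys A B)
  | all_ex (ys : List ℕ) (x : ℕ) (A B : Formula L) (hx : x ∉ A.freeVars) :
      Derives T (all (ys ++ [x]) B A) (all ys (ex x B) A)
  | cut {A B C : Formula L} (h₁ : Derives T A B) (h₂ : Derives T B C) : Derives T A C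
  | and_intro {A B C : Formula L} (h₁ : Derives T A B) (h₂ : Derives T A C) :
      Derives T A (and B C)
  | and_left {A B C : Formula L} (h : Derives T A (and B C)) : Derives T A B
  | and_right {A B C : Formula L} (h : Derives T A (and B C)) : Derives T A C
  | or_elim {A B C : Formula L} (h₁ : Derives T B A) (h₂ : Derives T C A) :
      Derives T (or B C) A
  | or_left {A B C : Formula L} (h : Derives T (or B C) A) : Derives T B A
  | or_right {A B C : Formula L} (h : Derives T (or B C) A) : Derives T C A
  | subst (xs : List ℕ) (σ : ℕ → L.Term ℕ) {A B : Formula L} (hσ : IsSubstitution xs σ)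
      (hA : FreeForSubst xs σ (A.subst σ)) (hB : FreeForSubst xs σ (B.subst σ))
      (h : Derives T A B) : Derives T (A.subst σ) (B.subst σ)
  | ex_elim (x : ℕ) {A B : Formula L} (hx : x ∉ A.freeVars) (h : Derives T B A) :
      Derives T (ex x B) A
  | ex_inv (x : ℕ) {A B : Formula L} (hx : x ∉ A.freeVars) (h : Derives T (ex x B) A) :
      Derives T B A
  | all_intro (xs : List ℕ) {A B C : Formula L} (hx : ∀ x ∈ xs, x ∉ A.freeVars)
      (h : Derives T (and A B) C) : Derives T A (all xs B C)

/-- `T ⊢ A`, meaning `T ⊢ ⊤ ⇒ A`. -/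
def Proves (T : Theory L) (A : Formula L) : Prop := Derives T top A

/-- `T + Γ` for a set `Γ` of sequents. -/
def Theory.add (T : Theory L) (Γ : Set (Sequent L)) : Theory L :=
  ⟨T.sequents ∪ Γ, T.rules⟩

/-- Languages that contain the symbols `0, S, +, ·`. -/
class ArithSymbols (L : FirstOrder.Language.{0, 0}) where
  zeroSym : L.Functions 0
  succSym : L.Functions 1
  addSym : L.Functions 2
  mulSym : L.Functions 2

section Arithmetic

variable [ArithSymbols L]

/-- The term `0`. -/
def zero : L.Term ℕ := FirstOrder.Language.Term.func ArithSymbols.zeroSym ![]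

/-- The term `S t`. -/
def succ (t : L.Term ℕ) : L.Term ℕ := FirstOrder.Language.Term.func ArithSymbols.succSym ![t]

/-- The term `s + t`. -/
def add (s t : L.Term ℕ) : L.Term ℕ := FirstOrder.Language.Term.func ArithSymbols.addSym ![s, t]

/-- The term `s · t`. -/
def mul (s t : L.Term ℕ) : L.Term ℕ := FirstOrder.Language.Term.func ArithSymbols.mulSym ![s, t]

/-- A variable that occurs neither in `s` nor in `t`. -/
def fresh (s t : L.Term ℕ) : ℕ := (s.varFinset ∪ t.varFinset).sup id + 1

/-- `s < t`, i.e. `∃ z (s + S z = t)` with `z` not in `s`, `t`. -/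
def lt (s t : L.Term ℕ) : Formula L :=
  ex (fresh s t) (eq (add s (succ (FirstOrder.Language.Term.var (fresh s t)))) t)

/-- `s ≤ t`, i.e. `s < t ∨ s = t`. -/
def le (s t : L.Term ℕ) : Formula L := or (lt s t) (eq s t)

/-- `Δ₀` formulas. -/
inductive IsDelta0 : Formula L → Prop
  | atomic {A : Formula L} : IsAtomic A → IsDelta0 A
  | and {A B : Formula L} : IsDelta0 A → IsDelta0 B → IsDelta0 (and A B)
  | or {A B : Formula L} : IsDelta0 A → IsDelta0 B → IsDelta0 (or A B)
  | imp {A B : Formula L} : IsDelta0 A → IsDelta0 B → IsDelta0 (imp A B)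
  | bex (x : ℕ) (s : L.Term ℕ) {A : Formula L} (hx : x ∉ s.varFinset) :
      IsDelta0 A → IsDelta0 (ex x (Formula.and (lt (FirstOrder.Language.Term.var x) s) A))
  | ball (x : ℕ) (s : L.Term ℕ) {A : Formula L} (hx : x ∉ s.varFinset) :
      IsDelta0 A → IsDelta0 (all [x] (lt (FirstOrder.Language.Term.var x) s) A)

/-- `Σ₁` formulas: `∃ xs A` with `A` in `Δ₀`. -/
def IsSigma1 (A : Formula L) : Prop :=
  ∃ (xs : List ℕ) (C : Formula L), IsDelta0 C ∧ A = exs xs C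

/-- The axioms of basic arithmetic, for formulas of `L`. -/
inductive BAAxiom : Sequent L → Prop
  | succ_ne_zero (x : ℕ) : BAAxiom ⟨eq (succ (FirstOrder.Language.Term.var x)) zero, bot⟩
  | succ_inj (x y : ℕ) :
      BAAxiom ⟨eq (succ (FirstOrder.Language.Term.var x)) (succ (FirstOrder.Language.Term.var y)),
        eq (FirstOrder.Language.Term.var x) (FirstOrder.Language.Term.var y)⟩
  | add_zero (x : ℕ) :
      BAAxiom ⟨top, eq (add (FirstOrder.Language.Term.var x) zero) (FirstOrder.Language.Term.var x)⟩
  | add_succ (x y : ℕ) :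
      BAAxiom ⟨top, eq (add (FirstOrder.Language.Term.var x) (succ (FirstOrder.Language.Term.var y)))
        (succ (add (FirstOrder.Language.Term.var x) (FirstOrder.Language.Term.var y)))⟩
  | mul_zero (x : ℕ) : BAAxiom ⟨top, eq (mul (FirstOrder.Language.Term.var x) zero) zero⟩
  | mul_succ (x y : ℕ) :
      BAAxiom ⟨top, eq (mul (FirstOrder.Language.Term.var x) (succ (FirstOrder.Language.Term.var y)))
        (add (mul (FirstOrder.Language.Term.var x) (FirstOrder.Language.Term.var y)) (FirstOrder.Language.Term.var x))⟩
  | induction (ys : List ℕ) (x : ℕ) (A : Formula L) :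
      BAAxiom ⟨all (ys ++ [x]) A (A.subst1 x (succ (FirstOrder.Language.Term.var x))),
        all (ys ++ [x]) (A.subst1 x zero) A⟩

/-- The rule of induction: from `A ⇒ A[x/Sx]` infer `A[x/0] ⇒ A`. -/
inductive InductionRule : Rule L → Prop
  | mk (x : ℕ) (A : Formula L) :
      InductionRule ⟨[⟨A, A.subst1 x (succ (FirstOrder.Language.Term.var x))⟩], ⟨A.subst1 x zero, A⟩⟩

variable (L) in
/-- Basic arithmetic `BA`, formulated in the language `L`. -/
def BA : Theory L := ⟨{S | BAAxiom S}, {R | InductionRule R}⟩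

variable (L) in
/-- Heyting arithmetic `HA`: the axioms and rules of `BA` over intuitionistic predicate calculus,
which is `BQC` with the schema `⊤ → A ⇒ A`. -/
def HA : Theory L := (BA L).add {S | ∃ A : Formula L, S = ⟨imp top A, A⟩}

/-- `T ⊢ MRDP`. -/
def ProvesMRDP (T : Theory L) : Prop :=
  ∀ A : Formula L, IsSigma1 A → ∃ B : Formula L,
    IsPositiveExistential B ∧ B.freeVars = A.freeVars ∧ Derives T A B ∧ Derives T B A

/-- `T ⊢ MRDP^w`. -/
def ProvesWeakMRDP (T : Theory L) : Prop :=
  ∀ A : Formula L, IsSigma1 A → ∃ B : Formula L,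
    IsPositiveExistential B ∧ B.freeVars = A.freeVars ∧ Proves T (iff A B)

/-- The formula `A` is a counterexample to `T ⊢ MRDP^w`. -/
def RefutesWeakMRDP (T : Theory L) (A : Formula L) : Prop :=
  IsSigma1 A ∧ ∀ B : Formula L,
    IsPositiveExistential B → B.freeVars = A.freeVars → ¬ Proves T (iff A B)

/-- The cancellation law `U`: `x + z = y + z ⇒ x = y`. -/
def cancellation : Sequent L :=
  ⟨eq (add (FirstOrder.Language.Term.var 0) (FirstOrder.Language.Term.var 2))
    (add (FirstOrder.Language.Term.var 1) (FirstOrder.Language.Term.var 2)),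
    eq (FirstOrder.Language.Term.var 0) (FirstOrder.Language.Term.var 1)⟩

end Arithmetic

/-- The function symbols `0, S, +, ·`. -/
inductive ArithFunc : ℕ → Type
  | zero : ArithFunc 0
  | succ : ArithFunc 1
  | add : ArithFunc 2
  | mul : ArithFunc 2

/-- The language `{0, S, +, ·}`. -/
def arith : FirstOrder.Language.{0, 0} := ⟨ArithFunc, fun _ => Empty⟩

instance : ArithSymbols arith := ⟨ArithFunc.zero, ArithFunc.succ, ArithFunc.add, ArithFunc.mul⟩

/-- The function symbols `0, S, +, ·` and the cut-off function. -/
inductive ArithCFunc : ℕ → Type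
  | zero : ArithCFunc 0
  | succ : ArithCFunc 1
  | add : ArithCFunc 2
  | mul : ArithCFunc 2
  | monus : ArithCFunc 2

/-- The language `{0, S, +, ·, ∸}`. -/
def arithC : FirstOrder.Language.{0, 0} := ⟨ArithCFunc, fun _ => Empty⟩

instance : ArithSymbols arithC :=
  ⟨ArithCFunc.zero, ArithCFunc.succ, ArithCFunc.add, ArithCFunc.mul⟩

/-- The term `s ∸ t`. -/
def monus (s t : arithC.Term ℕ) : arithC.Term ℕ :=
  FirstOrder.Language.Term.func (L := arithC) ArithCFunc.monus ![s, t]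

/-- `BA_c`: basic arithmetic for all formulas of `{0, S, +, ·, ∸}` with the axioms
`x ≤ y ⇒ x ∸ y = 0` and `y ≤ x ⇒ S x ∸ y = S (x ∸ y)`. -/
def BAc : Theory arithC :=
  (BA arithC).add
    {⟨le (FirstOrder.Language.Term.var 0) (FirstOrder.Language.Term.var 1),
        eq (monus (FirstOrder.Language.Term.var 0) (FirstOrder.Language.Term.var 1)) zero⟩,
      ⟨le (FirstOrder.Language.Term.var 1) (FirstOrder.Language.Term.var 0),
        eq (monus (succ (FirstOrder.Language.Term.var 0)) (FirstOrder.Language.Term.var 1))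
          (succ (monus (FirstOrder.Language.Term.var 0) (FirstOrder.Language.Term.var 1)))⟩}

end BasicArith

/-! In Kripke models of `BQC` accessibility is transitive but need not be reflexive, so a terminal
irreflexive node forces every implication. Forcing at such a node is expressed by `positivePart`;
forcing at an irreflexive node all of whose proper successors are of that kind is expressed by
`delayedPart`. Both readings are carried out syntactically: BA + Γ^∃ is closed under applying either
translation to both sides of a derivable sequent (`Derives.positivePart`, `Derives.delayedPart`).

Suppose BA + Γ^∃ proves (⊤ → ⊥) ↔ B with B in ∃₁⁺. The delayed part of (⊤ → ⊥) → B is ⊤ → B, because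
the antecedent has positive part ⊤ and B is its own positive part. So ⊤ → B is provable, and HA +
Γ^∃ proves B. The other half of the equivalence, B → (⊤ → ⊥), then gives ⊥ in HA + Γ^∃, against its
consistency.

For the three concrete theories the extra axioms contain no universal quantification, so they equal
their positive parts. The required consistency holds because HA with these axioms is classically
true in ℕ. -/

namespace BasicArith

open FirstOrder Formula

variable {L : FirstOrder.Language.{0, 0}}

/-! ### The two translations and their syntactic invariants -/

namespace Formula

/-- The formula obtained by replacing every outermost subformula `∀ xs (B → C)` by
`∀ xs (B^∃ → C^∃)`. It expresses forcing at an irreflexive node of which all proper successors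
are terminal and irreflexive. -/
def delayedPart : Formula L → Formula L
  | top => top
  | bot => bot
  | eq s t => eq s t
  | rel R ts => rel R ts
  | and A B => and A.delayedPart B.delayedPart
  | or A B => or A.delayedPart B.delayedPart
  | ex x A => ex x A.delayedPart
  | all xs A B => all xs A.positivePart B.positivePart

theorem positivePart_subst (A : Formula L) (σ : ℕ → L.Term ℕ) :
    (A.subst σ).positivePart = A.positivePart.subst σ := by
  induction A generalizing σ <;> simp_all [Formula.subst, positivePart]

theorem delayedPart_subst (A : Formula L) (σ : ℕ → L.Term ℕ) :
    (A.subst σ).delayedPart = A.delayedPart.subst σ := by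
  induction A generalizing σ <;>
    simp_all [Formula.subst, delayedPart, positivePart_subst]

theorem positivePart_subst1 (A : Formula L) (x : ℕ) (t : L.Term ℕ) :
    (A.subst1 x t).positivePart = A.positivePart.subst1 x t :=
  positivePart_subst A _

theorem delayedPart_subst1 (A : Formula L) (x : ℕ) (t : L.Term ℕ) :
    (A.subst1 x t).delayedPart = A.delayedPart.subst1 x t :=
  delayedPart_subst A _

/-- No universal quantification survives in a positive part, so neither translation changes it.
Hence the axioms in Γ^∃ are their own translations. -/
theorem positivePart_positivePart (A : Formula L) :
    A.positivePart.positivePart = A.positivePart := by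
  induction A <;> simp_all [positivePart]

theorem delayedPart_positivePart (A : Formula L) :
    A.positivePart.delayedPart = A.positivePart := by
  induction A <;> simp_all [positivePart, delayedPart]

theorem freeVars_positivePart_subset (A : Formula L) :
    A.positivePart.freeVars ⊆ A.freeVars := by
  induction A with
  | and A B hA hB => exact Finset.union_subset_union hA hB
  | or A B hA hB => exact Finset.union_subset_union hA hB
  | ex x A hA => exact Finset.sdiff_subset_sdiff hA subset_rfl
  | all xs A B => exact Finset.empty_subset _
  | _ => exact subset_rfl

theorem freeVars_delayedPart_subset (A : Formula L) :
    A.delayedPart.freeVars ⊆ A.freeVars := by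
  induction A with
  | and A B hA hB => exact Finset.union_subset_union hA hB
  | or A B hA hB => exact Finset.union_subset_union hA hB
  | ex x A hA => exact Finset.sdiff_subset_sdiff hA subset_rfl
  | all xs A B =>
    exact Finset.sdiff_subset_sdiff (Finset.union_subset_union
      (freeVars_positivePart_subset A) (freeVars_positivePart_subset B)) subset_rfl
  | _ => exact subset_rfl

theorem boundVars_positivePart_subset (A : Formula L) :
    A.positivePart.boundVars ⊆ A.boundVars := by
  induction A with
  | and A B hA hB => exact Finset.union_subset_union hA hB
  | or A B hA hB => exact Finset.union_subset_union hA hB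
  | ex x A hA => exact Finset.insert_subset_insert x hA
  | all xs A B => exact Finset.empty_subset _
  | _ => exact subset_rfl

theorem boundVars_delayedPart_subset (A : Formula L) :
    A.delayedPart.boundVars ⊆ A.boundVars := by
  induction A with
  | and A B hA hB => exact Finset.union_subset_union hA hB
  | or A B hA hB => exact Finset.union_subset_union hA hB
  | ex x A hA => exact Finset.insert_subset_insert x hA
  | all xs A B =>
    exact Finset.union_subset_union subset_rfl (Finset.union_subset_union
      (boundVars_positivePart_subset A) (boundVars_positivePart_subset B))
  | _ => exact subset_rfl

theorem IsAtomic.positivePart_eq {A : Formula L} (h : IsAtomic A) : A.positivePart = A := by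
  cases h <;> rfl

theorem IsAtomic.delayedPart_eq {A : Formula L} (h : IsAtomic A) : A.delayedPart = A := by
  cases h <;> rfl

theorem IsPositiveQF.positivePart_eq {A : Formula L} (h : IsPositiveQF A) :
    A.positivePart = A := by
  induction h with
  | atomic h => exact h.positivePart_eq
  | and _ _ h₁ h₂ => simp [positivePart, h₁, h₂]
  | or _ _ h₁ h₂ => simp [positivePart, h₁, h₂]

theorem IsPositiveExistential.positivePart_eq {A : Formula L} (h : IsPositiveExistential A) :
    A.positivePart = A := by
  obtain ⟨xs, C, hC, rfl⟩ := h
  induction xs with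
  | nil => exact hC.positivePart_eq
  | cons x xs ih => exact congrArg (ex x) ih

end Formula

theorem FreeForSubst.mono {xs : List ℕ} {σ : ℕ → L.Term ℕ} {A B : Formula L}
    (h : FreeForSubst xs σ A) (hBA : B.boundVars ⊆ A.boundVars) : FreeForSubst xs σ B :=
  fun v hv w hw hB => h v hv w hw (hBA hB)

/-! ### Derived rules of `BQC` -/

namespace Derives

variable {T T' : Theory L} {A B C D : Formula L}

theorem mono (hs : T.sequents ⊆ T'.sequents) (hr : T.rules ⊆ T'.rules) (h : Derives T A B) :
    Derives T' A B := by
  induction h with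
  | ofSequent S h => exact ofSequent S (hs h)
  | ofRule R h _ ih => exact ofRule R (hr h) ih
  | refl => exact refl _
  | top_intro => exact top_intro _
  | bot_elim => exact bot_elim _
  | and_or => exact and_or _ _ _
  | and_ex x A B hx => exact and_ex x A B hx
  | eq_refl => exact eq_refl _
  | eq_subst x y A hA => exact eq_subst x y A hA
  | all_trans => exact all_trans _ _ _ _
  | all_and => exact all_and _ _ _ _
  | all_or => exact all_or _ _ _ _
  | all_subst xs σ A B hσ hA hB => exact all_subst xs σ A B hσ hA hB
  | all_requantify xs ys A B hy => exact all_requantify xs ys A B hy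
  | all_ex ys x A B hx => exact all_ex ys x A B hx
  | cut _ _ h₁ h₂ => exact cut h₁ h₂
  | and_intro _ _ h₁ h₂ => exact and_intro h₁ h₂
  | and_left _ h => exact and_left h
  | and_right _ h => exact and_right h
  | or_elim _ _ h₁ h₂ => exact or_elim h₁ h₂
  | or_left _ h => exact or_left h
  | or_right _ h => exact or_right h
  | subst xs σ hσ hA hB _ h => exact subst xs σ hσ hA hB h
  | ex_elim x hx _ h => exact ex_elim x hx h
  | ex_inv x hx _ h => exact ex_inv x hx h
  | all_intro xs hx _ h => exact all_intro xs hx h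

theorem and_mono (h₁ : Derives T A B) (h₂ : Derives T C D) :
    Derives T (Formula.and A C) (Formula.and B D) :=
  and_intro (cut (and_left (refl _)) h₁) (cut (and_right (refl _)) h₂)

theorem or_mono (h₁ : Derives T A B) (h₂ : Derives T C D) :
    Derives T (Formula.or A C) (Formula.or B D) :=
  or_elim (cut h₁ (or_left (refl _))) (cut h₂ (or_right (refl _)))

theorem ex_mono (x : ℕ) (h : Derives T A B) : Derives T (ex x A) (ex x B) := by
  have hx : x ∉ (ex x B).freeVars := by simp [freeVars]
  exact ex_elim x hx (cut h (ex_inv x hx (refl _)))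

/-- The two translations differ only at outermost universal subformulas, where the positive part is
⊤, and ∧, ∨, ∃ are monotone. This is persistence: what is forced at a node stays forced at its
successors. -/
theorem delayedPart_positivePart (T : Theory L) (A : Formula L) :
    Derives T A.delayedPart A.positivePart := by
  induction A with
  | and A B hA hB => exact and_mono hA hB
  | or A B hA hB => exact or_mono hA hB
  | ex x A hA => exact ex_mono x hA
  | all xs A B => exact top_intro _
  | _ => exact refl _

theorem imp_of_derives (h : Derives T A B) : Proves T (imp A B) :=
  all_intro [] (by simp) (cut (and_right (refl _)) h)

end Derives

theorem Derives.ofPositive {T : Theory L} {Γ : Set (Sequent L)} {S : Sequent L} (h : S ∈ Γ) :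
    Derives (T.add (positiveSequents Γ)) S.ante.positivePart S.conc.positivePart :=
  ofSequent ⟨_, _⟩ (Or.inr ⟨S, h, rfl⟩)

theorem boundVars_subst (A : Formula L) (σ : ℕ → L.Term ℕ) :
    (A.subst σ).boundVars = A.boundVars := by
  induction A generalizing σ <;> simp_all [Formula.subst, boundVars]

/-- Outside `xs` the substitution is the identity, so the exception `w ≠ y` covers those variables.
This is the form of the side condition that `sat_subst` uses. -/
theorem FreeForSubst.not_mem_boundVars {xs : List ℕ} {σ : ℕ → L.Term ℕ} {A : Formula L}
    (h : FreeForSubst xs σ A) (hσ : IsSubstitution xs σ) (y : ℕ) :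
    ∀ w ∈ (σ y).varFinset, w ≠ y → w ∉ A.boundVars := by
  intro w hw e
  by_cases hy : y ∈ xs
  · exact h y hy w hw
  · rw [hσ y hy] at hw
    exact absurd (by simpa [Language.Term.varFinset] using hw) e

/-! ### Closure of BA + Γ^∃ under both translations -/

section Arithmetic

variable [ArithSymbols L]

theorem Derives.ofBA {Γ : Set (Sequent L)} {A B : Formula L} (h : BAAxiom ⟨A, B⟩) :
    Derives ((BA L).add Γ) A B :=
  ofSequent ⟨A, B⟩ (Or.inl h)

theorem Derives.inductionRule {Γ : Set (Sequent L)} {A : Formula L} {x : ℕ}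
    (h : Derives ((BA L).add Γ) A (A.subst1 x (succ (Language.Term.var x)))) :
    Derives ((BA L).add Γ) (A.subst1 x zero) A :=
  ofRule (T := (BA L).add Γ) _ (InductionRule.mk x A : InductionRule _) (by simpa using h)

/-- Axioms and rules whose conclusion has a universal formula on the right become trivial, since
that side turns into ⊤; the others commute with the translation. The schema ⊤ → A ⇒ A would become ⊤
⇒ A^∃, so the argument is confined to BA. -/
theorem Derives.positivePart {Γ : Set (Sequent L)} {A B : Formula L}
    (h : Derives ((BA L).add (positiveSequents Γ)) A B) :
    Derives ((BA L).add (positiveSequents Γ)) A.positivePart B.positivePart := by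
  induction h with
  | ofSequent S h =>
    rcases h with h | ⟨S', hS', rfl⟩
    · cases h with
      | induction => exact top_intro _
      | succ_ne_zero x => exact .ofBA (.succ_ne_zero x)
      | succ_inj x y => exact .ofBA (.succ_inj x y)
      | add_zero x => exact .ofBA (.add_zero x)
      | add_succ x y => exact .ofBA (.add_succ x y)
      | mul_zero x => exact .ofBA (.mul_zero x)
      | mul_succ x y => exact .ofBA (.mul_succ x y)
    · simp only [positivePart_positivePart]
      exact .ofPositive hS'
  | ofRule R h _ ih =>
    cases h with
    | mk x A =>
      have ih := ih _ (List.mem_singleton_self _)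
      simp only [positivePart_subst1] at ih ⊢
      exact .inductionRule ih
  | refl => exact refl _
  | top_intro => exact top_intro _
  | bot_elim => exact bot_elim _
  | and_or => exact and_or _ _ _
  | and_ex x A B hx => exact and_ex x _ _ fun h => hx (freeVars_positivePart_subset A h)
  | eq_refl => exact eq_refl _
  | eq_subst x y A hA =>
    rw [positivePart_subst1]
    simp only [Formula.positivePart, hA.positivePart_eq]
    exact eq_subst x y A hA
  | all_trans => exact top_intro _
  | all_and => exact top_intro _
  | all_or => exact top_intro _
  | all_subst xs σ A B hσ hA hB => exact top_intro _
  | all_requantify xs ys A B hy => exact top_intro _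
  | all_ex ys x A B hx => exact top_intro _
  | cut _ _ h₁ h₂ => exact cut h₁ h₂
  | and_intro _ _ h₁ h₂ => exact and_intro h₁ h₂
  | and_left _ h => exact and_left h
  | and_right _ h => exact and_right h
  | or_elim _ _ h₁ h₂ => exact or_elim h₁ h₂
  | or_left _ h => exact or_left h
  | or_right _ h => exact or_right h
  | subst xs σ hσ hA hB _ h =>
    have hA := hA.mono (boundVars_positivePart_subset _)
    have hB := hB.mono (boundVars_positivePart_subset _)
    rw [positivePart_subst] at hA hB ⊢
    rw [positivePart_subst]
    exact subst xs σ hσ hA hB h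
  | ex_elim x hx _ h => exact ex_elim x (fun h => hx (freeVars_positivePart_subset _ h)) h
  | ex_inv x hx _ h => exact ex_inv x (fun h => hx (freeVars_positivePart_subset _ h)) h
  | all_intro xs hx _ h => exact top_intro _

/-- Positive parts commute with ∧, ∨, ∃ and substitution, so each axiom on universal formulas,
induction included, becomes an instance of itself for positive parts. Only ∀-introduction needs the
other translation. -/
theorem Derives.delayedPart {Γ : Set (Sequent L)} {A B : Formula L}
    (h : Derives ((BA L).add (positiveSequents Γ)) A B) :
    Derives ((BA L).add (positiveSequents Γ)) A.delayedPart B.delayedPart := by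
  induction h with
  | ofSequent S h =>
    rcases h with h | ⟨S', hS', rfl⟩
    · cases h with
      | induction ys x A =>
        simp only [Formula.delayedPart, positivePart_subst1]
        exact .ofBA (.induction ys x A.positivePart)
      | succ_ne_zero x => exact .ofBA (.succ_ne_zero x)
      | succ_inj x y => exact .ofBA (.succ_inj x y)
      | add_zero x => exact .ofBA (.add_zero x)
      | add_succ x y => exact .ofBA (.add_succ x y)
      | mul_zero x => exact .ofBA (.mul_zero x)
      | mul_succ x y => exact .ofBA (.mul_succ x y)
    · simp only [Formula.delayedPart_positivePart]
      exact .ofPositive hS'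
  | ofRule R h _ ih =>
    cases h with
    | mk x A =>
      have ih := ih _ (List.mem_singleton_self _)
      simp only [delayedPart_subst1] at ih ⊢
      exact .inductionRule ih
  | refl => exact refl _
  | top_intro => exact top_intro _
  | bot_elim => exact bot_elim _
  | and_or => exact and_or _ _ _
  | and_ex x A B hx => exact and_ex x _ _ fun h => hx (freeVars_delayedPart_subset A h)
  | eq_refl => exact eq_refl _
  | eq_subst x y A hA =>
    rw [delayedPart_subst1]
    simp only [Formula.delayedPart, hA.delayedPart_eq]
    exact eq_subst x y A hA
  | all_trans => exact all_trans _ _ _ _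
  | all_and => exact all_and _ _ _ _
  | all_or => exact all_or _ _ _ _
  | all_subst xs σ A B hσ hA hB =>
    simp only [Formula.delayedPart, positivePart_subst]
    exact all_subst xs σ _ _ hσ (hA.mono (boundVars_positivePart_subset _))
      (hB.mono (boundVars_positivePart_subset _))
  | all_requantify xs ys A B hy =>
    exact all_requantify xs ys _ _ fun y hys h =>
      hy y hys (freeVars_delayedPart_subset (all xs A B) h)
  | all_ex ys x A B hx => exact all_ex ys x _ _ fun h => hx (freeVars_positivePart_subset A h)
  | cut _ _ h₁ h₂ => exact cut h₁ h₂
  | and_intro _ _ h₁ h₂ => exact and_intro h₁ h₂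
  | and_left _ h => exact and_left h
  | and_right _ h => exact and_right h
  | or_elim _ _ h₁ h₂ => exact or_elim h₁ h₂
  | or_left _ h => exact or_left h
  | or_right _ h => exact or_right h
  | subst xs σ hσ hA hB _ h =>
    have hA := hA.mono (boundVars_delayedPart_subset _)
    have hB := hB.mono (boundVars_delayedPart_subset _)
    rw [delayedPart_subst] at hA hB ⊢
    rw [delayedPart_subst]
    exact subst xs σ hσ hA hB h
  | ex_elim x hx _ h => exact ex_elim x (fun h => hx (freeVars_delayedPart_subset _ h)) h
  | ex_inv x hx _ h => exact ex_inv x (fun h => hx (freeVars_delayedPart_subset _ h)) h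
  -- The premise is used one level up, through its positive part instead of the induction
  -- hypothesis; persistence turns the delayed part of the context into its positive part.
  | all_intro xs hx h _ =>
    exact all_intro xs (fun x hxs h => hx x hxs (freeVars_delayedPart_subset _ h))
      (cut (and_mono (delayedPart_positivePart _ _) (refl _)) h.positivePart)

/-! ### The refutation, relative to consistency over HA -/

theorem Derives.toHA {Γ : Set (Sequent L)} {A B : Formula L} (h : Derives ((BA L).add Γ) A B) :
    Derives ((HA L).add Γ) A B :=
  Derives.mono (T := (BA L).add Γ) (T' := (HA L).add Γ)
    (Set.union_subset_union_left _ Set.subset_union_left) (subset_refl (BA L).rules) h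

/-- Transitivity of implication yields only ⊤ → B; the schema ⊤ → B ⇒ B of HA removes the guard. -/
theorem Derives.modusPonens {Γ : Set (Sequent L)} {A B : Formula L}
    (h : Proves ((HA L).add Γ) (imp A B)) (hA : Proves ((HA L).add Γ) A) :
    Proves ((HA L).add Γ) B :=
  cut (cut (and_intro (imp_of_derives hA) h) (all_trans _ _ _ _))
    (ofSequent ⟨imp top B, B⟩ (Or.inl (Or.inr ⟨B, rfl⟩)))

theorem isSigma1_imp_top_bot : IsSigma1 (imp top bot : Formula L) :=
  ⟨[], _, .imp (.atomic .top) (.atomic .bot), rfl⟩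

theorem refutesWeakMRDP_of_consistent {Γ : Set (Sequent L)}
    (hΓ : ¬ Proves ((HA L).add (positiveSequents Γ)) bot) :
    RefutesWeakMRDP ((BA L).add (positiveSequents Γ)) (imp top bot) := by
  refine ⟨isSigma1_imp_top_bot, fun B hB _ h => hΓ ?_⟩
  -- The antecedent ⊤ → ⊥ of the first implication has positive part ⊤.
  have h₁ : Proves ((BA L).add (positiveSequents Γ)) (imp top B.positivePart) :=
    Derives.and_left (Derives.delayedPart h)
  rw [hB.positivePart_eq] at h₁
  have hB : Proves ((HA L).add (positiveSequents Γ)) B :=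
    Derives.modusPonens h₁.toHA (Derives.refl _)
  have h₂ : Proves ((HA L).add (positiveSequents Γ)) (imp B (imp top bot)) :=
    (Derives.and_right h).toHA
  exact Derives.modusPonens (Derives.modusPonens h₂ hB) (Derives.refl _)

theorem RefutesWeakMRDP.not_provesWeakMRDP {T : Theory L} {A : Formula L}
    (h : RefutesWeakMRDP T A) : ¬ ProvesWeakMRDP T := fun hT => by
  obtain ⟨B, hB, hfree, hAB⟩ := hT A h.1
  exact h.2 B hB hfree hAB

theorem ProvesMRDP.provesWeakMRDP {T : Theory L} (h : ProvesMRDP T) : ProvesWeakMRDP T :=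
  fun A hA => by
    obtain ⟨B, hB, hfree, hAB, hBA⟩ := h A hA
    exact ⟨B, hB, hfree, .and_intro (.imp_of_derives hAB) (.imp_of_derives hBA)⟩

theorem RefutesWeakMRDP.failure {T : Theory L} {A : Formula L} (h : RefutesWeakMRDP T A) :
    ¬ ProvesWeakMRDP T ∧ ¬ ProvesMRDP T ∧ RefutesWeakMRDP T A :=
  ⟨h.not_provesWeakMRDP, fun hT => h.not_provesWeakMRDP hT.provesWeakMRDP, h⟩

end Arithmetic

/-! ### Classical soundness over structures on ℕ -/

section Semantics

variable [L.Structure ℕ]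

/-- Classical satisfaction in a structure on the natural numbers. -/
def Formula.Sat : Formula L → (ℕ → ℕ) → Prop
  | top, _ => True
  | bot, _ => False
  | eq s t, v => s.realize v = t.realize v
  | rel R ts, v => Language.Structure.RelMap R fun i => (ts i).realize v
  | and A B, v => A.Sat v ∧ B.Sat v
  | or A B, v => A.Sat v ∨ B.Sat v
  | ex x A, v => ∃ a, A.Sat (Function.update v x a)
  | all xs A B, v => ∀ w : ℕ → ℕ, (∀ y, y ∉ xs → w y = v y) → A.Sat w → B.Sat w

theorem realize_congr (t : L.Term ℕ) {v w : ℕ → ℕ} (h : ∀ y ∈ t.varFinset, v y = w y) :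
    t.realize v = t.realize w := by
  induction t with
  | var x => exact h x (by simp [Language.Term.varFinset])
  | func f ts ih =>
    refine congrArg (Language.Structure.funMap f) (funext fun i => ih i fun y hy => h y ?_)
    exact Finset.mem_biUnion.2 ⟨i, Finset.mem_univ _, hy⟩

theorem Formula.Sat.congr {A : Formula L} {v w : ℕ → ℕ} (hA : A.Sat v)
    (h : ∀ y ∈ A.freeVars, v y = w y) : A.Sat w := by
  induction A generalizing v w with
  | top => trivial
  | bot => exact hA
  | eq s t =>
    have hs := realize_congr s fun y hy => h y (Finset.mem_union_left _ hy)
    have ht := realize_congr t fun y hy => h y (Finset.mem_union_right _ hy)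
    exact hs.symm.trans (Eq.trans hA ht)
  | rel R ts =>
    have hts : (fun i => (ts i).realize v) = fun i => (ts i).realize w :=
      funext fun i => realize_congr (ts i) fun y hy =>
        h y (Finset.mem_biUnion.2 ⟨i, Finset.mem_univ _, hy⟩)
    simpa only [Formula.Sat, hts] using hA
  | and A B ihA ihB =>
    exact ⟨ihA hA.1 fun y hy => h y (Finset.mem_union_left _ hy),
      ihB hA.2 fun y hy => h y (Finset.mem_union_right _ hy)⟩
  | or A B ihA ihB =>
    exact hA.imp (ihA · fun y hy => h y (Finset.mem_union_left _ hy))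
      (ihB · fun y hy => h y (Finset.mem_union_right _ hy))
  | ex x A ih =>
    obtain ⟨a, ha⟩ := hA
    refine ⟨a, ih ha fun y hy => ?_⟩
    by_cases hyx : y = x
    · simp [hyx]
    · simpa [hyx] using h y (by simp [freeVars, hy, hyx])
  | all xs A B ihA ihB =>
    intro w' hw' hA'
    -- The hypothesis is instantiated at the mixed valuation: `w'` on the quantified variables, `v`
    -- elsewhere.
    have key : ∀ y ∈ A.freeVars ∪ B.freeVars, w' y = if y ∈ xs then w' y else v y := by
      intro y hy
      by_cases hyx : y ∈ xs
      · simp [hyx]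
      · rw [if_neg hyx, hw' y hyx]
        exact (h y (Finset.mem_sdiff.2 ⟨hy, by simpa using hyx⟩)).symm
    refine ihB (hA (fun y => if y ∈ xs then w' y else v y) (fun y hy => if_neg hy)
      (ihA hA' fun y hy => key y (Finset.mem_union_left _ hy))) fun y hy => ?_
    exact (key y (Finset.mem_union_right _ hy)).symm

theorem sat_ex_of_not_mem {A : Formula L} {x : ℕ} (hx : x ∉ A.freeVars) {v : ℕ → ℕ} {a : ℕ} :
    A.Sat (Function.update v x a) ↔ A.Sat v := by
  have h : ∀ y ∈ A.freeVars, Function.update v x a y = v y := fun y hy =>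
    Function.update_of_ne (fun e : y = x => hx (e ▸ hy)) _ _
  exact ⟨fun hA => hA.congr h, fun hA => hA.congr fun y hy => (h y hy).symm⟩

/-- The variable `y` may occur in `σ y` even if bound in `A`, since a quantifier on `y` resets that
entry to `y`. The exception is needed for A[x/Sx] in induction, which has no side condition. -/
theorem sat_subst (A : Formula L) (σ : ℕ → L.Term ℕ) (v : ℕ → ℕ)
    (h : ∀ y, ∀ w ∈ (σ y).varFinset, w ≠ y → w ∉ A.boundVars) :
    (A.subst σ).Sat v ↔ A.Sat fun y => (σ y).realize v := by
  induction A generalizing σ v with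
  | top => rfl
  | bot => rfl
  | eq s t => simp [Formula.subst, Formula.Sat]
  | rel R ts => simp [Formula.subst, Formula.Sat]
  | and A B ihA ihB =>
    exact and_congr (ihA σ v fun y w hw e hb => h y w hw e (Finset.mem_union_left _ hb))
      (ihB σ v fun y w hw e hb => h y w hw e (Finset.mem_union_right _ hb))
  | or A B ihA ihB =>
    exact or_congr (ihA σ v fun y w hw e hb => h y w hw e (Finset.mem_union_left _ hb))
      (ihB σ v fun y w hw e hb => h y w hw e (Finset.mem_union_right _ hb))
  | ex x A ih =>
    refine exists_congr fun a => (ih _ _ fun y w hw e hb => ?_).trans (iff_of_eq ?_)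
    · by_cases hy : y = x
      · exact e (by simpa [hy, Language.Term.varFinset] using hw)
      · rw [if_neg hy] at hw
        exact h y w hw e (Finset.mem_insert_of_mem hb)
    · congr 1
      funext y
      by_cases hy : y = x
      · simp [hy]
      · rw [if_neg hy, Function.update_of_ne hy]
        refine realize_congr _ fun w hw => Function.update_of_ne (fun e => ?_) _ _
        exact h y w hw (fun e' => hy (e'.symm.trans e)) (by simp [boundVars, e])
  | all xs A B ihA ihB =>
    set τ : ℕ → L.Term ℕ := fun y => if y ∈ xs then Language.Term.var y else σ y with hτ
    have hbound : ∀ y, ∀ w ∈ (τ y).varFinset, w ≠ y → w ∉ A.boundVars ∪ B.boundVars := by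
      intro y w hw e hb
      by_cases hy : y ∈ xs
      · exact e (by simpa [hτ, hy, Language.Term.varFinset] using hw)
      · simp only [hτ, if_neg hy] at hw
        exact h y w hw e (Finset.mem_union_right _ hb)
    have hA := fun w => ihA τ w fun y u hu e hb => hbound y u hu e (Finset.mem_union_left _ hb)
    have hB := fun w => ihB τ w fun y u hu e hb => hbound y u hu e (Finset.mem_union_right _ hb)
    have hval : ∀ w : ℕ → ℕ, (∀ y, y ∉ xs → w y = v y) → ∀ y, y ∉ xs →
        (σ y).realize w = (σ y).realize v := by
      intro w hw y hy
      refine realize_congr _ fun u hu => hw u fun hus => ?_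
      exact h y u hu (fun e => hy (e ▸ hus)) (Finset.mem_union_left _ (by simpa using hus))
    constructor
    · intro H w hw hAw
      -- Evaluating `τ` at the valuation that is `w` on `xs` and `v` elsewhere recovers `w`.
      have hv : ∀ y, y ∉ xs → (if y ∈ xs then w y else v y) = v y := fun y hy => if_neg hy
      have hwτ : (fun y => (τ y).realize fun y => if y ∈ xs then w y else v y) = w := by
        funext y
        by_cases hy : y ∈ xs
        · simp [hτ, hy]
        · simp only [hτ, if_neg hy]
          rw [hval _ hv y hy, hw y hy]
      have := H _ hv ((hA _).2 (by rwa [hwτ]))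
      rw [← hwτ]
      exact (hB _).1 this
    · intro H w hw hAw
      refine (hB w).2 (H _ (fun y hy => ?_) ((hA w).1 hAw))
      simp only [hτ, if_neg hy]
      exact hval w hw y hy

theorem sat_subst1 (A : Formula L) (x : ℕ) (t : L.Term ℕ) (v : ℕ → ℕ)
    (h : ∀ w ∈ t.varFinset, w ≠ x → w ∉ A.boundVars) :
    (A.subst1 x t).Sat v ↔ A.Sat (Function.update v x (t.realize v)) := by
  refine (sat_subst A _ v fun y w hw e => ?_).trans (iff_of_eq ?_)
  · by_cases hy : y = x
    · subst hy
      exact h w (by simpa using hw) e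
    · exact absurd (by simpa [hy, Language.Term.varFinset] using hw) e
  · congr 1
    funext y
    by_cases hy : y = x <;> simp [hy]

/-- A sequent holds under all valuations. -/
def Sequent.Valid (S : Sequent L) : Prop := ∀ v, S.ante.Sat v → S.conc.Sat v

theorem Derives.valid {T : Theory L} {A B : Formula L} (hs : ∀ S ∈ T.sequents, S.Valid)
    (hr : ∀ R ∈ T.rules, (∀ S ∈ R.premises, S.Valid) → R.conclusion.Valid)
    (h : Derives T A B) : ∀ v, A.Sat v → B.Sat v := by
  induction h with
  | ofSequent S h => exact hs S h
  | ofRule R h _ ih => exact hr R h ih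
  | refl => exact fun v h => h
  | top_intro => exact fun v _ => trivial
  | bot_elim => exact fun v h => h.elim
  | and_or => exact fun v h => and_or_left.1 h
  | and_ex x A B hx =>
    rintro v ⟨hA, a, ha⟩
    exact ⟨a, (sat_ex_of_not_mem hx).2 hA, ha⟩
  | eq_refl => exact fun v _ => rfl
  | eq_subst x y A hA =>
    rintro v ⟨hxy, hv⟩
    refine (sat_subst1 A x _ v fun w _ _ => by cases hA <;> simp [boundVars]).2 ?_
    -- Updating `x` to the value of `y` therefore leaves the valuation unchanged.
    have : v x = v y := hxy
    simpa [← this] using hv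
  | all_trans => exact fun v h w hw hA => h.2 w hw (h.1 w hw hA)
  | all_and => exact fun v h w hw hA => ⟨h.1 w hw hA, h.2 w hw hA⟩
  | all_or => exact fun v h w hw hA => hA.elim (h.1 w hw) (h.2 w hw)
  | all_subst xs σ A B hσ hA hB =>
    intro v h w hw hAw
    rw [sat_subst _ _ _ (hA.not_mem_boundVars hσ)] at hAw
    rw [sat_subst _ _ _ (hB.not_mem_boundVars hσ)]
    exact h _ (fun y hy => by simpa [hσ y hy] using hw y hy) hAw
  | all_requantify xs ys A B hy =>
    intro v h w hw
    exact h.congr (w := w) (fun y hyf => (hw y fun hys => hy y hys hyf).symm) w fun _ _ => rfl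
  | all_ex ys x A B hx =>
    rintro v h w hw ⟨a, ha⟩
    refine (sat_ex_of_not_mem hx).1 (h _ (fun y hy => ?_) ha)
    simp only [List.mem_append, List.mem_singleton, not_or] at hy
    rw [Function.update_of_ne hy.2, hw y hy.1]
  | cut _ _ h₁ h₂ => exact fun v h => h₂ v (h₁ v h)
  | and_intro _ _ h₁ h₂ => exact fun v h => ⟨h₁ v h, h₂ v h⟩
  | and_left _ ih => exact fun v h => (ih v h).1
  | and_right _ ih => exact fun v h => (ih v h).2
  | or_elim _ _ h₁ h₂ => exact fun v h => h.elim (h₁ v) (h₂ v)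
  | or_left _ ih => exact fun v h => ih v (.inl h)
  | or_right _ ih => exact fun v h => ih v (.inr h)
  | subst xs σ hσ hA hB _ ih =>
    intro v h
    have hA := hA.not_mem_boundVars hσ
    have hB := hB.not_mem_boundVars hσ
    simp only [boundVars_subst] at hA hB
    exact (sat_subst _ _ _ hB).2 (ih _ ((sat_subst _ _ _ hA).1 h))
  | ex_elim x hx _ ih =>
    rintro v ⟨a, ha⟩
    exact (sat_ex_of_not_mem hx).1 (ih _ ha)
  | @ex_inv x _ _ hx _ ih =>
    intro v h
    exact ih v ⟨v x, by rwa [Function.update_eq_self]⟩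
  | all_intro xs hx _ ih =>
    intro v h w hw hB
    exact ih w ⟨h.congr fun y hy => (hw y fun hys => hx y hys hy).symm, hB⟩

theorem sat_of_induction {A : Formula L} {x : ℕ} {v : ℕ → ℕ}
    (h₀ : A.Sat (Function.update v x 0))
    (hS : ∀ a, A.Sat (Function.update v x a) → A.Sat (Function.update v x (a + 1))) :
    A.Sat v := by
  have h : ∀ a, A.Sat (Function.update v x a) := fun a => Nat.rec h₀ hS a
  simpa using h (v x)

/-! ### Truth of HA in the standard model -/

variable [ArithSymbols L]

variable (L) in
/-- The symbols `0, S, +, ·` have their standard interpretation. -/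
class IsStandard : Prop where
  realize_zero (v : ℕ → ℕ) : (zero : L.Term ℕ).realize v = 0
  realize_succ (v : ℕ → ℕ) (t : L.Term ℕ) : (succ t).realize v = t.realize v + 1
  realize_add (v : ℕ → ℕ) (s t : L.Term ℕ) : (add s t).realize v = s.realize v + t.realize v
  realize_mul (v : ℕ → ℕ) (s t : L.Term ℕ) : (mul s t).realize v = s.realize v * t.realize v

attribute [simp] IsStandard.realize_zero IsStandard.realize_succ IsStandard.realize_add
  IsStandard.realize_mul

variable [IsStandard L]

theorem sat_subst1_zero (A : Formula L) (x : ℕ) (v : ℕ → ℕ) :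
    (A.subst1 x zero).Sat v ↔ A.Sat (Function.update v x 0) := by
  rw [sat_subst1 _ _ _ _ (by simp [zero, Language.Term.varFinset]), IsStandard.realize_zero]

theorem sat_subst1_succ (A : Formula L) (x : ℕ) (v : ℕ → ℕ) :
    (A.subst1 x (succ (Language.Term.var x))).Sat v ↔ A.Sat (Function.update v x (v x + 1)) := by
  rw [sat_subst1 _ _ _ _ (by simp [succ, Language.Term.varFinset]), IsStandard.realize_succ,
    Language.Term.realize_var]

theorem BAAxiom.valid {S : Sequent L} (h : BAAxiom S) : S.Valid := by
  cases h with
  | induction ys x A =>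
    intro v h w hw h₀
    rw [sat_subst1_zero] at h₀
    refine sat_of_induction h₀ fun a ha => ?_
    -- Since `x` is itself quantified, the updated valuation still agrees with `v` off the
    -- quantified variables.
    have := h (Function.update w x a) (fun y hy => ?_) ha
    · simpa [sat_subst1_succ] using this
    · rw [Function.update_of_ne (by rintro rfl; simp at hy), hw y hy]
  | succ_ne_zero x => intro v; simp [Formula.Sat]
  | succ_inj x y => intro v; simp [Formula.Sat]
  | add_zero x => intro v; simp [Formula.Sat]
  | add_succ x y => intro v; simp [Formula.Sat, Nat.add_assoc]
  | mul_zero x => intro v; simp [Formula.Sat]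
  | mul_succ x y => intro v; simp [Formula.Sat, Nat.mul_succ]

theorem InductionRule.valid {R : Rule L} (h : InductionRule R)
    (hR : ∀ S ∈ R.premises, S.Valid) : R.conclusion.Valid := by
  cases h with
  | mk x A =>
    intro v h₀
    rw [sat_subst1_zero] at h₀
    refine sat_of_induction h₀ fun a ha => ?_
    simpa [sat_subst1_succ] using hR _ (List.mem_singleton_self _) _ ha

theorem HA_add_consistent {Γ : Set (Sequent L)} (hΓ : ∀ S ∈ Γ, S.Valid) :
    ¬ Proves ((HA L).add Γ) bot := by
  intro h
  refine Derives.valid (T := (HA L).add Γ) (fun S hS => ?_) (fun R hR => InductionRule.valid hR) h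
    (fun _ => 0) trivial
  rcases hS with (hS | ⟨A, rfl⟩) | hS
  · exact BAAxiom.valid hS
  -- The schema ⊤ → A ⇒ A: classically the implication is evaluated at `v` itself.
  · exact fun v h => h v (fun _ _ => rfl) trivial
  · exact hΓ S hS

theorem refutesWeakMRDP_of_valid {Γ : Set (Sequent L)} (hΓ : ∀ S ∈ Γ, S.Valid)
    (hpos : positiveSequents Γ = Γ) : RefutesWeakMRDP ((BA L).add Γ) (imp top bot) := by
  have h : ¬ Proves ((HA L).add (positiveSequents Γ)) bot := by
    rw [hpos]
    exact HA_add_consistent hΓ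
  simpa only [hpos] using refutesWeakMRDP_of_consistent h

theorem sat_lt {s t : L.Term ℕ} {v : ℕ → ℕ} : (lt s t).Sat v ↔ s.realize v < t.realize v := by
  have hfresh : ∀ y ∈ s.varFinset ∪ t.varFinset, y ≠ fresh s t := fun y hy =>
    (Nat.lt_succ_of_le (Finset.le_sup (f := id) hy)).ne
  have hs : ∀ a, s.realize (Function.update v (fresh s t) a) = s.realize v := fun a =>
    realize_congr s fun y hy =>
      Function.update_of_ne (hfresh y (Finset.mem_union_left _ hy)) _ _
  have ht : ∀ a, t.realize (Function.update v (fresh s t) a) = t.realize v := fun a =>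
    realize_congr t fun y hy =>
      Function.update_of_ne (hfresh y (Finset.mem_union_right _ hy)) _ _
  simp only [lt, Formula.Sat, IsStandard.realize_add, IsStandard.realize_succ, hs, ht,
    Language.Term.realize_var, Function.update_self]
  constructor
  · rintro ⟨a, ha⟩
    omega
  · intro h
    -- One is subtracted because the witness `z` enters as `S z`.
    exact ⟨t.realize v - s.realize v - 1, by omega⟩

theorem sat_le {s t : L.Term ℕ} {v : ℕ → ℕ} : (le s t).Sat v ↔ s.realize v ≤ t.realize v := by
  rw [Nat.le_iff_lt_or_eq, ← sat_lt]
  rfl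

end Semantics

/-! ### The theories BA, BA + U and BA_c -/

instance : arith.Structure ℕ where
  funMap f xs := match f with
    | ArithFunc.zero => 0
    | ArithFunc.succ => xs 0 + 1
    | ArithFunc.add => xs 0 + xs 1
    | ArithFunc.mul => xs 0 * xs 1
  RelMap R := R.elim

instance : IsStandard arith :=
  ⟨fun _ => rfl, fun _ _ => rfl, fun _ _ _ => rfl, fun _ _ _ => rfl⟩

instance : arithC.Structure ℕ where
  funMap f xs := match f with
    | ArithCFunc.zero => 0
    | ArithCFunc.succ => xs 0 + 1
    | ArithCFunc.add => xs 0 + xs 1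
    | ArithCFunc.mul => xs 0 * xs 1
    | ArithCFunc.monus => xs 0 - xs 1
  RelMap R := R.elim

instance : IsStandard arithC :=
  ⟨fun _ => rfl, fun _ _ => rfl, fun _ _ _ => rfl, fun _ _ _ => rfl⟩

theorem cancellation_valid : (cancellation : Sequent arith).Valid := by
  intro v
  simp [cancellation, Formula.Sat]

theorem refutesWeakMRDP_BA : RefutesWeakMRDP (BA arith) (imp top bot) := by
  have h := refutesWeakMRDP_of_valid (L := arith) (Γ := ∅) (by simp) (Set.image_empty _)
  rwa [Theory.add, Set.union_empty] at h

theorem refutesWeakMRDP_BA_add_cancellation :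
    RefutesWeakMRDP ((BA arith).add {cancellation}) (imp top bot) :=
  refutesWeakMRDP_of_valid (by simpa using cancellation_valid) (Set.image_singleton ..)

theorem refutesWeakMRDP_BAc : RefutesWeakMRDP BAc (imp top bot) := by
  -- The formula `le` is built from equations by ∃ and ∨, so both axioms compute to their own
  -- positive parts.
  refine refutesWeakMRDP_of_valid ?_ (Set.image_pair ..)
  rintro S (rfl | rfl) v h
  · have h := sat_le.1 h
    exact Nat.sub_eq_zero_of_le h
  · have h := sat_le.1 h
    exact Nat.succ_sub h

end BasicArith

theorem mainTheorem10 :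
    (∀ Γ : Set (BasicArith.Sequent BasicArith.arith),
      ¬ BasicArith.Proves
          ((BasicArith.HA BasicArith.arith).add (BasicArith.positiveSequents Γ))
          BasicArith.Formula.bot →
      ¬ BasicArith.ProvesWeakMRDP
          ((BasicArith.BA BasicArith.arith).add (BasicArith.positiveSequents Γ)) ∧
      BasicArith.RefutesWeakMRDP
          ((BasicArith.BA BasicArith.arith).add (BasicArith.positiveSequents Γ))
          (BasicArith.Formula.imp BasicArith.Formula.top BasicArith.Formula.bot)) ∧
    (¬ BasicArith.ProvesWeakMRDP (BasicArith.BA BasicArith.arith) ∧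
      ¬ BasicArith.ProvesMRDP (BasicArith.BA BasicArith.arith) ∧
      BasicArith.RefutesWeakMRDP (BasicArith.BA BasicArith.arith)
        (BasicArith.Formula.imp BasicArith.Formula.top BasicArith.Formula.bot)) ∧
    (¬ BasicArith.ProvesWeakMRDP
          ((BasicArith.BA BasicArith.arith).add {BasicArith.cancellation}) ∧
      ¬ BasicArith.ProvesMRDP
          ((BasicArith.BA BasicArith.arith).add {BasicArith.cancellation}) ∧
      BasicArith.RefutesWeakMRDP
          ((BasicArith.BA BasicArith.arith).add {BasicArith.cancellation})
          (BasicArith.Formula.imp BasicArith.Formula.top BasicArith.Formula.bot)) ∧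
    (¬ BasicArith.ProvesWeakMRDP BasicArith.BAc ∧
      ¬ BasicArith.ProvesMRDP BasicArith.BAc ∧
      BasicArith.RefutesWeakMRDP BasicArith.BAc
        (BasicArith.Formula.imp BasicArith.Formula.top BasicArith.Formula.bot)) :=
  ⟨fun _ hΓ =>
      have h := BasicArith.refutesWeakMRDP_of_consistent hΓ
      ⟨h.not_provesWeakMRDP, h⟩,
    BasicArith.refutesWeakMRDP_BA.failure,
    BasicArith.refutesWeakMRDP_BA_add_cancellation.failure,
    BasicArith.refutesWeakMRDP_BAc.failure⟩
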